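/- **The hierarchy.** For functions $q_1,q_2,\dots$ of $t_1=x,t_2,\dots$ and $d\ge 1$ define the potentials $V_i^{(k)}(q_1,\dots,q_d)$, $k\ge 0$, by $V_i^{(0)}=\delta_{id}$ and $V_i^{(k+1)}=V_{i+1}^{(k)}-q_iV_1^{(k)}$ for $1\le i\le d$, with $V_i^{(k)}=0$ for $i\notin\{1,\dots,d\}$, and for $N\ge 1$ the Lagrangian $$L^{d,-N,0}=\frac14\sum_{i,j=1}^{d}V_1^{(2d+N-i-j)}\,q_{i,x}q_{j,x}-\frac14V_1^{(0)},\qquad E_i(L)=\frac{\partial L}{\partial q_i}-\frac{d}{dx}\frac{\partial L}{\partial q_{i,x}} .$$ The Killing systems in $d$ variables are $q_{t_r}=Z_r^d[q]$ with $$(Z_r^d[q])^j=(q_{j+r-1})_x+\sum_{k=1}^{j-1}\bigl(q_k(q_{j+r-k-1})_x-q_{j+r-k-1}(q_k)_x\bigr),\qquad q_\alpha:=0\ \text{for}\ \alpha>d .$$ The first $R$ flows $\bar q_{t_r}=\overline Z_r^N[\bar q]$, $r=2,\dots,R+1$, $\bar q=(q_1,\dots,q_N)^T$, of the $N$-component nonlocal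 (integral) coupled Harry Dym hierarchy are obtained with $d=N+R$ from the first $N$ components of $q_{t_r}=Z_r^d[q]$ by eliminating $q_{N+1},\dots,q_d$ by means of the equations $E_i(L^{d,-N,0})=0$, $i=N+1,\dots,d$, which determine $q_{N+1},\dots,q_d$ successively through two integrations in $x$ each. The functions of $t_2,t_3,\dots$ that arise in these integrations are part of the solution. Thus smooth functions $q_1,\dots,q_N$ on an open set of times solve the first $R$ flows if there are smooth functions $q_{N+1},\dots,q_{N+R}$ on this set such that $E_i(L^{N+R,-N,0})=0$ for $i=N+1,\dots,N+R$ and $(q_j)_{t_r}=(Z_r^{N+R}[q])^j$ for $j=1,\dots,N$, $r=2,\dots,R+1$. **Theorem.** Let $n,N\ge 1$, $\beta\in\{0,\dots,n-1\}$, $a_j,c_j\in\mathbf R$ and $\sigma_j\in\{1,-1\}$ for $j=1,\dots,n$. Let $\lambda_1,\dots,\lambda_n$ be differentiable real functions of $(t_1,\dots,t_n)$ on an open set $U\subset\mathbf R^n$ that are given implicitly by $$t_i+c_i=\frac12\sum_{r=1}^{n}\sigma_r\int\frac{\lambda_r^{\,n-i}}{\sqrt{\lambda_r^{\,\beta-N}\Bigl(\sum_{j=1}^{n}a_j\lambda_r^{\,n-j}-\frac14\lambda_r^{-\beta}\Bigr)}}\,d\lambda_r,\qquad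 i=1,\dots,n,$$ where the integrals denote antiderivatives on open sets $I_r\subset\mathbf R\setminus\{0\}$ on which the expression under the root is positive, and $\lambda_r$ takes its values in $I_r$. Let $$q_i=(-1)^i\sum_{1\le s_1<\dots<s_i\le n}\lambda_{s_1}\cdots\lambda_{s_i},\qquad i=1,\dots,N$$ (so $q_i=0$ if $i>n$), regarded as functions of $x=t_1,t_2,\dots,t_n$. Then $q_1,\dots,q_N$ solve on $U$ the first $n-\beta$ flows (the first $n-1$ flows if $\beta\in\{0,1\}$) of the $N$-component nonlocal coupled Harry Dym hierarchy. The times $t_2,\dots,t_{n-\beta+1}$ ($t_2,\dots,t_n$ if $\beta\in\{0,1\}$) are the evolution parameters, and the remaining $t_i$ are free parameters. -/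

import Mathlib

open Finset

namespace NonlocalCHD

/-! Times `(t_1, …, t_n)` are points of `Fin n → ℝ`; the coordinate `t_i` is `t ⟨i - 1, _⟩`, and
`x = t_1`. Families of dependent variables `q_1, q_2, …` are sequences indexed by `ℕ`, of which
only the entries with positive index are used, so that all indices below are one-based. -/

/-- The partial derivative `∂f/∂t_i` (one-based index `1 ≤ i ≤ n`). -/
noncomputable def dt {n : ℕ} (i : ℕ) (f : (Fin n → ℝ) → ℝ) (t : Fin n → ℝ) : ℝ :=
  fderiv ℝ f t (fun j => if (j : ℕ) + 1 = i then 1 else 0)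

/-- The derivative with respect to the space variable `x = t_1`. -/
noncomputable def dx {n : ℕ} (f : (Fin n → ℝ) → ℝ) (t : Fin n → ℝ) : ℝ := dt 1 f t

/-- The Viète polynomial `q_i = (-1)^i ∑_{s_1 < … < s_i} λ_{s_1} ⋯ λ_{s_i}`
(an empty sum, hence `0`, for `i > n`). -/
def viete {n : ℕ} (i : ℕ) (z : Fin n → ℝ) : ℝ :=
  (-1) ^ i * ∑ S ∈ powersetCard i univ, ∏ s ∈ S, z s

/-! ### Separable potentials and Lagrangians in Viète coordinates -/

/-- The potentials `V_i^{(k)}` for `k ≥ 0`: `V_i^{(0)} = δ_{i n}` and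
`V_i^{(k+1)} = V_{i+1}^{(k)} - q_i V_1^{(k)}` for `1 ≤ i ≤ n`, with `V_i^{(k)} = 0` for `i`
outside `{1, …, n}`. -/
noncomputable def potentialUp (n : ℕ) (q : ℕ → ℝ) : ℕ → ℕ → ℝ
  | 0, i => if 1 ≤ i ∧ i = n then 1 else 0
  | k + 1, i =>
      if 1 ≤ i ∧ i ≤ n then potentialUp n q k (i + 1) - q i * potentialUp n q k 1 else 0

/-- The potentials `V_r^{(-k)}` for `k ≥ 0`, by the reversed recursion
`V_r^{(k)} = V_{r-1}^{(k+1)} - (q_{r-1} / q_n) V_n^{(k+1)}`, where `q_0 = 1`. -/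
noncomputable def potentialDown (n : ℕ) (q : ℕ → ℝ) : ℕ → ℕ → ℝ
  | 0, r => potentialUp n q 0 r
  | k + 1, r =>
      if 1 ≤ r ∧ r ≤ n then
        potentialDown n q k (r - 1)
          - (if r = 1 then 1 else q (r - 1)) / q n * potentialDown n q k n
      else 0

/-- The separable potential `V_i^{(k)}(q_1, …, q_n)`, `k ∈ ℤ`. -/
noncomputable def potential (n : ℕ) (q : ℕ → ℝ) : ℤ → ℕ → ℝ
  | Int.ofNat k, i => potentialUp n q k i
  | Int.negSucc k, i => potentialDown n q (k + 1) i

/-- The covariant metric tensor `g^{(m)}` in Viète coordinates, `g_{ij} = V_1^{(2n - m - i - j)}`.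
This is the metric `∑_r λ_r^{-m} ∏_{s ≠ r} (λ_r - λ_s) dλ_r²` written in the coordinates `q`. -/
noncomputable def metric (n : ℕ) (m : ℤ) (q : ℕ → ℝ) (i j : ℕ) : ℝ :=
  potential n q (2 * n - m - i - j) 1

/-- The Lagrangian `L^{n,m,k}(q, q_x) = ¼ q_xᵀ g^{(m)} q_x - ¼ V_1^{(k)}`. -/
noncomputable def lagrangian (n : ℕ) (m k : ℤ) (q v : ℕ → ℝ) : ℝ :=
  1 / 4 * ∑ i ∈ Icc 1 n, ∑ j ∈ Icc 1 n, metric n m q i j * v i * v j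
    - 1 / 4 * potential n q k 1

/-- The Euler–Lagrange expression `E_i(L) = ∂L/∂q_i - d/dx (∂L/∂q_{i,x})`, evaluated along the
functions `q_1(t), q_2(t), …`. -/
noncomputable def eulerLagrange {n : ℕ} (L : (ℕ → ℝ) → (ℕ → ℝ) → ℝ) (i : ℕ)
    (q : ℕ → (Fin n → ℝ) → ℝ) (t : Fin n → ℝ) : ℝ :=
  deriv (fun y => L (Function.update (fun j => q j t) i y) (fun j => dx (q j) t)) (q i t)
    - dx (fun τ => deriv
        (fun w => L (fun j => q j τ) (Function.update (fun j => dx (q j) τ) i w)) (dx (q i) τ)) t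

/-! ### Killing systems and the nonlocal hierarchy -/

/-- The family `q_1, q_2, …` with the convention `q_α = 0` for `α > d`. -/
noncomputable def cut {n : ℕ} (d : ℕ) (q : ℕ → (Fin n → ℝ) → ℝ) (α : ℕ) : (Fin n → ℝ) → ℝ :=
  if α ≤ d then q α else 0

/-- The `j`-th component `(Z_i^d[q])^j` of the `i`-th Killing vector field in `d` Viète
coordinates:
`(q_{j+i-1})_x + ∑_{k=1}^{j-1} (q_k (q_{j+i-k-1})_x - q_{j+i-k-1} (q_k)_x)`. -/
noncomputable def killingField {n : ℕ} (d i j : ℕ) (q : ℕ → (Fin n → ℝ) → ℝ)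
    (t : Fin n → ℝ) : ℝ :=
  dx (cut d q (j + i - 1)) t
    + ∑ k ∈ Icc 1 (j - 1),
        (cut d q k t * dx (cut d q (j + i - k - 1)) t
          - cut d q (j + i - k - 1) t * dx (cut d q k) t)

/-- `u_1, …, u_N` solve, on the open set `U` of times, the first `R` flows
`ū_{t_r} = Z̄_r^N[ū]`, `r = 2, …, R + 1`, of the `N`-component nonlocal coupled Harry Dym
hierarchy (meant for `R + 1 ≤ n`, so that the times `t_2, …, t_{R+1}` are present).

Put `d = N + R`. The flows are the first `N` components of the Killing systems
`q_{t_r} = Z_r^d[q]`, in which `q_{N+1}, …, q_d` stand for nonlocal functions of `q_1, …, q_N`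
obtained by solving the last `d - N` Euler–Lagrange equations `E_i(L^{d,-N,0}) = 0`,
`i = N + 1, …, d`; these have the form `-½ q_{d+N+1-i,xx} + φ_{d+1-i}[q_1, …, q_{d+N-i}] = 0`.
The functions of `t_2, t_3, …` that occur in the two integrations with respect to `x` are part of
the solution, hence `q_{N+1}, …, q_d` are quantified existentially; the same functions serve all
`R` flows. -/
def SolvesFirstFlows {n : ℕ} (N R : ℕ) (U : Set (Fin n → ℝ)) (u : ℕ → (Fin n → ℝ) → ℝ) : Prop :=
  ∃ q : ℕ → (Fin n → ℝ) → ℝ,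
    (∀ j, 1 ≤ j → j ≤ N → Set.EqOn (q j) (u j) U) ∧
    (∀ j, 1 ≤ j → j ≤ N + R → ContDiffOn ℝ (⊤ : ℕ∞) (q j) U) ∧
    (∀ i, N + 1 ≤ i → i ≤ N + R → ∀ t ∈ U,
      eulerLagrange (lagrangian (N + R) (-(N : ℤ)) 0) i q t = 0) ∧
    (∀ r, 2 ≤ r → r ≤ R + 1 → ∀ j, 1 ≤ j → j ≤ N → ∀ t ∈ U,
      dt r (q j) t = killingField (N + R) r j q t)

/-! ### The separable quadratures -/

/-- The function `z^m (∑_{j=1}^n a_j z^{n-j} - ¼ z^k)` under the square root. -/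
noncomputable def radicand (n : ℕ) (m k : ℤ) (a : Fin n → ℝ) (z : ℝ) : ℝ :=
  z ^ m * (∑ j : Fin n, a j * z ^ (n - ((j : ℕ) + 1)) - 1 / 4 * z ^ k)

/-- The differentiable functions `λ_1(t), …, λ_n(t)` on the open set `U` of times are given
implicitly by
`t_i + c_i = ½ ∑_r σ_r ∫ λ_r^{n-i} / √(λ_r^m (∑_j a_j λ_r^{n-j} - ¼ λ_r^k)) dλ_r`, `i = 1, …, n`,
with signs `σ_r = ±1`: `F i r` is an antiderivative of the `i`-th integrand on an open set `I r`
on which the radicand is defined and positive and in which `λ_r` takes its values. -/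
def IsSeparableSolution {n : ℕ} (m k : ℤ) (a c σ : Fin n → ℝ) (U : Set (Fin n → ℝ))
    (lam : (Fin n → ℝ) → Fin n → ℝ) : Prop :=
  IsOpen U ∧ DifferentiableOn ℝ lam U ∧ (∀ r, σ r = 1 ∨ σ r = -1) ∧
    ∃ (I : Fin n → Set ℝ) (F : Fin n → Fin n → ℝ → ℝ),
      (∀ r, IsOpen (I r)) ∧
      (∀ r, ∀ z ∈ I r, z ≠ 0 ∧ 0 < radicand n m k a z) ∧
      (∀ i r, ∀ z ∈ I r,
        HasDerivAt (F i r) (z ^ (n - ((i : ℕ) + 1)) / Real.sqrt (radicand n m k a z)) z) ∧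
      (∀ t ∈ U, ∀ r, lam t r ∈ I r) ∧
      (∀ t ∈ U, ∀ i, t i + c i = 1 / 2 * ∑ r, σ r * F i r (lam t r))

end NonlocalCHD

/-!
The nonlocal variables are simply the next Viète polynomials: `q_i = viete i λ` for all `i`, so that
`P = ∏_r (1 - λ_r X) = 1 + q_1 X + q_2 X² + ⋯`. Differentiating the quadratures and inverting a
Vandermonde matrix gives `∂λ_r/∂t_{j+1} = p_j ∂λ_r/∂x`, where `p_0, p_1, …` are the coefficients of
`P / (1 - λ_r X)`, and `∂λ_r/∂x ∏_{s ≠ r} (λ_r - λ_s) = ± 2 √radicand ≠ 0`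
(`IsSeparableSolution.dt_mul_prod`, `IsSeparableSolution.dt_eq`). Hence the `λ_r` are distinct and, by
bootstrapping, smooth.

*Killing systems.* Since `q_k = p_k - λ_r p_{k-1}`, the product `p_{j-1} p_{r-1}` is a telescoping sum
of the bilinear expressions in the Killing field (`mul_eq_telescoping_sum`), and summing over all the
`λ_r` gives `IsSeparableSolution.dt_viete_eq_killingField`.

*Euler–Lagrange equations.* The potentials `V_1^{(k)}` are the coefficients of `X^{d-1} / Q` with
`Q = 1 + q_1 X + ⋯ + q_d X^d`. So `L^{d,-N,0}` is, up to a constant, `¼` times the coefficient of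
`X^{d+N+1}` in `Q_x² / Q`, and `E_i` is `¼` times the coefficient of `X^{d+N+1-i}` in
`Q_x² / Q² - 2 Q_{xx} / Q` (`eulerLagrange_eq_coeff`). For `N < i ≤ d` these exponents run through
`N + 1, …, d`. On the other hand, with `C` the polynomial of the spectral curve, `P_x² + C - 2 P P_{xx}`
vanishes to second order at every `1/λ_r`, hence is `P² K` with `deg K ≤ N`
(`IsSeparableSolution.exists_finiteGap`). As `C` has no terms of degree at most `N + n - β`, the
coefficients of `P_x² / P² - 2 P_{xx} / P` agree with those of `K` up to this order, and those beyond
`X^N` vanish.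
-/

namespace NonlocalCHD

/-! ### Directional derivatives of functions and of power series -/

section Calculus

variable {E : Type*} [NormedAddCommGroup E] [NormedSpace ℝ E]

/-- `f` is differentiable at `x` and its derivative in the direction `v` is `f'`. Differentiability is
part of the notion, so that `f'` is never the junk value of `fderiv`. -/
def HasDirDeriv (f : E → ℝ) (f' : ℝ) (x v : E) : Prop :=
  DifferentiableAt ℝ f x ∧ fderiv ℝ f x v = f'

lemma hasDirDeriv_const (a : ℝ) (x v : E) : HasDirDeriv (fun _ => a) 0 x v :=
  ⟨differentiableAt_const a, by simp⟩

lemma HasDirDeriv.add {f g : E → ℝ} {f' g' : ℝ} {x v : E} (hf : HasDirDeriv f f' x v)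
    (hg : HasDirDeriv g g' x v) : HasDirDeriv (fun y => f y + g y) (f' + g') x v := by
  refine ⟨hf.1.add hg.1, ?_⟩
  rw [fderiv_fun_add hf.1 hg.1, ← hf.2, ← hg.2]
  simp

lemma HasDirDeriv.mul {f g : E → ℝ} {f' g' : ℝ} {x v : E} (hf : HasDirDeriv f f' x v)
    (hg : HasDirDeriv g g' x v) :
    HasDirDeriv (fun y => f y * g y) (f' * g x + f x * g') x v := by
  refine ⟨hf.1.mul hg.1, ?_⟩
  rw [fderiv_fun_mul hf.1 hg.1, ← hf.2, ← hg.2]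
  simp
  ring

lemma HasDirDeriv.sum {ι : Type*} {s : Finset ι} {f : ι → E → ℝ} {f' : ι → ℝ} {x v : E}
    (hf : ∀ i ∈ s, HasDirDeriv (f i) (f' i) x v) :
    HasDirDeriv (fun y => ∑ i ∈ s, f i y) (∑ i ∈ s, f' i) x v := by
  refine ⟨DifferentiableAt.fun_sum fun i hi => (hf i hi).1, ?_⟩
  rw [fderiv_fun_sum fun i hi => (hf i hi).1, _root_.sum_apply]
  exact sum_congr rfl fun i hi => (hf i hi).2

/-- The chain rule with a scalar function on the outside. -/
lemma HasDirDeriv.comp {g : ℝ → ℝ} {g' : ℝ} {f : E → ℝ} {f' : ℝ} {x v : E}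
    (hg : HasDerivAt g g' (f x)) (hf : HasDirDeriv f f' x v) :
    HasDirDeriv (fun y => g (f y)) (g' * f') x v := by
  have h := hg.comp_hasFDerivAt x hf.1.hasFDerivAt
  exact ⟨h.differentiableAt, by rw [← hf.2]; exact congrArg (· v) h.fderiv⟩

lemma HasDirDeriv.congr_of_eventuallyEq {f g : E → ℝ} {f' : ℝ} {x v : E}
    (hf : HasDirDeriv f f' x v) (h : g =ᶠ[nhds x] f) : HasDirDeriv g f' x v :=
  ⟨hf.1.congr_of_eventuallyEq h, by rw [h.fderiv_eq]; exact hf.2⟩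

lemma HasDirDeriv.unique {f : E → ℝ} {f' f'' : ℝ} {x v : E} (h : HasDirDeriv f f' x v)
    (h' : HasDirDeriv f f'' x v) : f' = f'' :=
  h.2.symm.trans h'.2

lemma HasDirDeriv.deriv {f : ℝ → ℝ} {f' x : ℝ} (h : HasDirDeriv f f' x 1) :
    deriv f x = f' := by
  rw [← h.2, fderiv_apply_one_eq_deriv]

/-- Coefficientwise directional derivative of a function with values in power series. -/
def HasCoeffDeriv (F : E → PowerSeries ℝ) (F' : PowerSeries ℝ) (x v : E) : Prop :=
  ∀ m, HasDirDeriv (fun y => PowerSeries.coeff m (F y)) (PowerSeries.coeff m F') x v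

lemma hasCoeffDeriv_const (A : PowerSeries ℝ) (x v : E) : HasCoeffDeriv (fun _ => A) 0 x v :=
  fun m => by simpa using hasDirDeriv_const (PowerSeries.coeff m A) x v

lemma HasCoeffDeriv.unique {F : E → PowerSeries ℝ} {F' F'' : PowerSeries ℝ} {x v : E}
    (h : HasCoeffDeriv F F' x v) (h' : HasCoeffDeriv F F'' x v) : F' = F'' :=
  PowerSeries.ext fun m => (h m).unique (h' m)

lemma HasCoeffDeriv.add {F G : E → PowerSeries ℝ} {F' G' : PowerSeries ℝ} {x v : E}
    (hF : HasCoeffDeriv F F' x v) (hG : HasCoeffDeriv G G' x v) :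
    HasCoeffDeriv (fun y => F y + G y) (F' + G') x v := fun m => by
  simpa using (hF m).add (hG m)

lemma HasCoeffDeriv.mul {F G : E → PowerSeries ℝ} {F' G' : PowerSeries ℝ} {x v : E}
    (hF : HasCoeffDeriv F F' x v) (hG : HasCoeffDeriv G G' x v) :
    HasCoeffDeriv (fun y => F y * G y) (F' * G x + F x * G') x v := fun m => by
  simp only [PowerSeries.coeff_mul, map_add, ← sum_add_distrib]
  exact HasDirDeriv.sum fun p _ => (hF p.1).mul (hG p.2)

lemma HasCoeffDeriv.prod {ι : Type*} [DecidableEq ι] {s : Finset ι} {F : ι → E → PowerSeries ℝ}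
    {F' : ι → PowerSeries ℝ} {x v : E} (hF : ∀ i ∈ s, HasCoeffDeriv (F i) (F' i) x v) :
    HasCoeffDeriv (fun y => ∏ i ∈ s, F i y) (∑ i ∈ s, F' i * ∏ k ∈ s.erase i, F k x) x v := by
  induction s using Finset.induction_on with
  | empty => simpa using hasCoeffDeriv_const (1 : PowerSeries ℝ) x v
  | insert a s ha ih =>
    have h := (hF a (mem_insert_self a s)).mul (ih fun i hi => hF i (mem_insert_of_mem hi))
    simp only [prod_insert ha, sum_insert ha, erase_insert ha]
    convert h using 2
    rw [mul_sum]
    refine sum_congr rfl fun i hi => ?_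
    have hia : i ≠ a := fun h => ha (h ▸ hi)
    rw [erase_insert_of_ne hia.symm, prod_insert fun h => ha (mem_of_mem_erase h)]
    ring

/-- The derivative of an inverse is found by differentiating `F * F⁻¹ = 1`, once the recursion for
the coefficients of `F⁻¹` has shown that they are differentiable. -/
lemma HasCoeffDeriv.inv {F : E → PowerSeries ℝ} {F' : PowerSeries ℝ} {x v : E}
    (hF : HasCoeffDeriv F F' x v) (h1 : ∀ y, PowerSeries.constantCoeff (F y) = 1) :
    HasCoeffDeriv (fun y => (F y)⁻¹) (-(F' * (F x)⁻¹ ^ 2)) x v := by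
  have hdiff : ∀ m, DifferentiableAt ℝ (fun y => PowerSeries.coeff m (F y)⁻¹) x := by
    intro m
    induction m using Nat.strong_induction_on with
    | _ m ih =>
      have hrec := funext fun y => (PowerSeries.coeff_inv m (F y)).trans (by rw [h1])
      rw [hrec]
      split_ifs with h
      · exact differentiableAt_const _
      · refine DifferentiableAt.const_mul (DifferentiableAt.fun_sum fun p _ => ?_) _
        split_ifs with hp
        · exact (hF p.1).1.mul (ih p.2 hp)
        · exact differentiableAt_const _
  have hG : HasCoeffDeriv (fun y => (F y)⁻¹)
      (PowerSeries.mk fun m => fderiv ℝ (fun y => PowerSeries.coeff m (F y)⁻¹) x v) x v :=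
    fun m => ⟨hdiff m, by simp⟩
  have hinv : ∀ y, F y * (F y)⁻¹ = 1 := fun y =>
    PowerSeries.mul_inv_cancel _ (by rw [h1]; exact one_ne_zero)
  have hmul := hF.mul hG
  simp only [hinv] at hmul
  have h0 := hmul.unique (hasCoeffDeriv_const 1 x v)
  convert hG using 1
  linear_combination (-(F x)⁻¹) * h0 +
    (PowerSeries.mk fun m => fderiv ℝ (fun y => PowerSeries.coeff m (F y)⁻¹) x v) * hinv x

end Calculus

/-! ### Generating functions of the potentials and the Euler–Lagrange expressions -/

section Lagrangian

/-- The truncated generating function `∑_{i=1}^d v_i X^i`. -/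
noncomputable def truncSeries (d : ℕ) (v : ℕ → ℝ) : PowerSeries ℝ :=
  ∑ i ∈ Icc 1 d, PowerSeries.C (v i) * PowerSeries.X ^ i

lemma coeff_truncSeries (d : ℕ) (v : ℕ → ℝ) (m : ℕ) :
    PowerSeries.coeff m (truncSeries d v) = if m ∈ Icc 1 d then v m else 0 := by
  simp [truncSeries, PowerSeries.coeff_X_pow]

lemma constantCoeff_one_add_truncSeries (d : ℕ) (v : ℕ → ℝ) :
    PowerSeries.constantCoeff (1 + truncSeries d v) = 1 := by
  rw [← PowerSeries.coeff_zero_eq_constantCoeff_apply, map_add, coeff_truncSeries]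
  simp

lemma hasCoeffDeriv_truncSeries {E : Type*} [NormedAddCommGroup E] [NormedSpace ℝ E] {d : ℕ}
    {f : ℕ → E → ℝ} {f' : ℕ → ℝ} {x v : E}
    (hf : ∀ i ∈ Icc 1 d, HasDirDeriv (f i) (f' i) x v) :
    HasCoeffDeriv (fun y => truncSeries d fun i => f i y) (truncSeries d f') x v := fun m => by
  simp only [coeff_truncSeries]
  split_ifs with h
  · exact hf m h
  · exact hasDirDeriv_const 0 x v

lemma hasCoeffDeriv_truncSeries_update {d i : ℕ} (hi : i ∈ Icc 1 d) (v : ℕ → ℝ) (w : ℝ) :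
    HasCoeffDeriv (fun w => truncSeries d (Function.update v i w)) (PowerSeries.X ^ i) w 1 := by
  intro m
  simp only [coeff_truncSeries, PowerSeries.coeff_X_pow]
  rcases eq_or_ne m i with rfl | hm
  · simp only [hi, if_true, Function.update_self]
    exact ⟨differentiableAt_id, by simp⟩
  · simp only [Function.update_of_ne hm, hm, if_false]
    exact hasDirDeriv_const _ _ _

/-- The recursion for `V_i^{(k)}`, unrolled down to `V_1^{(0)}, …, V_1^{(k-1)}`. -/
lemma potentialUp_eq_sub_sum (d : ℕ) (q : ℕ → ℝ) (k : ℕ) : ∀ i, 1 ≤ i →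
    potentialUp d q k i = (if i + k = d then 1 else 0) - ∑ l ∈ range k,
      (if i + l ≤ d then q (i + l) else 0) * potentialUp d q (k - 1 - l) 1 := by
  induction k with
  | zero => intro i hi; simp [potentialUp, hi]
  | succ k ih =>
    intro i hi
    by_cases hid : i ≤ d
    · rw [potentialUp, if_pos ⟨hi, hid⟩, ih (i + 1) (by omega), sum_range_succ']
      simp only [add_zero, hid, if_true, Nat.add_sub_cancel, Nat.sub_zero]
      have h2 : ∀ l, i + 1 + l = i + (l + 1) := fun l => by omega
      have h3 : ∀ l, k - 1 - l = k - (l + 1) := fun l => by omega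
      simp only [h2, h3]
      ring
    · rw [potentialUp, if_neg (by omega), if_neg (by omega), sum_eq_zero]
      · simp
      · intro l _
        rw [if_neg (by omega), zero_mul]

/-- The potentials `V_1^{(k)}` have the generating function `X^{d-1} / (1 + q_1 X + ⋯ + q_d X^d)`. -/
lemma potentialUp_one_eq_coeff {d : ℕ} (hd : 1 ≤ d) (q : ℕ → ℝ) (k : ℕ) :
    potentialUp d q k 1 =
      PowerSeries.coeff k (PowerSeries.X ^ (d - 1) * (1 + truncSeries d q)⁻¹) := by
  have h0 : PowerSeries.constantCoeff (1 + truncSeries d q) ≠ 0 := by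
    rw [constantCoeff_one_add_truncSeries]; exact one_ne_zero
  have h : (PowerSeries.mk fun k => potentialUp d q k 1) =
      PowerSeries.X ^ (d - 1) * (1 + truncSeries d q)⁻¹ := by
    rw [PowerSeries.eq_mul_inv_iff_mul_eq h0]
    ext k
    rw [mul_add, mul_one, mul_comm _ (truncSeries d q), map_add, PowerSeries.coeff_mk,
      PowerSeries.coeff_mul, PowerSeries.coeff_X_pow, potentialUp_eq_sub_sum d q k 1 le_rfl,
      Finset.Nat.sum_antidiagonal_eq_sum_range_succ_mk, sum_range_succ']
    have h1 : (1 + k = d) = (k = d - 1) := by rw [eq_iff_iff]; omega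
    simp only [coeff_truncSeries, PowerSeries.coeff_mk, h1]
    have h2 : ∀ l, k - 1 - l = k - (l + 1) := fun l => by omega
    have h3 : ∀ l, (1 + l ≤ d) = (l + 1 ∈ Icc 1 d) := fun l => by
      rw [mem_Icc, eq_iff_iff]; omega
    simp only [h2, h3]
    simp [add_comm 1]
  rw [← h, PowerSeries.coeff_mk]

/-- The kinetic energy of `L^{d,-N,0}` is a coefficient of `Q_x² / Q`, where
`Q = 1 + q_1 X + ⋯ + q_d X^d`; its potential does not depend on `q`. -/
lemma lagrangian_eq_coeff {d : ℕ} (hd : 1 ≤ d) (N : ℕ) (q v : ℕ → ℝ) :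
    lagrangian d (-(N : ℤ)) 0 q v =
      1 / 4 * PowerSeries.coeff (d + N + 1) (truncSeries d v ^ 2 * (1 + truncSeries d q)⁻¹)
        - 1 / 4 * (if 1 = d then 1 else 0) := by
  have hpot : potential d q 0 1 = if 1 = d then 1 else 0 := by
    change potentialUp d q 0 1 = _
    simp [potentialUp]
  have hsq : PowerSeries.coeff (d + N + 1) (truncSeries d v ^ 2 * (1 + truncSeries d q)⁻¹) =
      PowerSeries.coeff (2 * d + N) (truncSeries d v ^ 2 *
        (PowerSeries.X ^ (d - 1) * (1 + truncSeries d q)⁻¹)) := by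
    rw [mul_left_comm, PowerSeries.coeff_X_pow_mul', if_pos (by omega),
      show 2 * d + N - (d - 1) = d + N + 1 by omega]
  rw [lagrangian, hpot, hsq]
  congr 2
  rw [truncSeries, sq, sum_mul_sum, sum_mul, map_sum]
  refine sum_congr rfl fun i hi => ?_
  rw [sum_mul, map_sum]
  refine sum_congr rfl fun j hj => ?_
  rw [mem_Icc] at hi hj
  rw [metric, show (2 * (d : ℤ) - -(N : ℤ) - i - j) = ((2 * d + N - (i + j) : ℕ) : ℤ) by omega]
  change potentialUp d q _ 1 * _ * _ = _
  have hs : ∀ Y : PowerSeries ℝ, PowerSeries.coeff (2 * d + N) (PowerSeries.X ^ (i + j) * Y) =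
      PowerSeries.coeff (2 * d + N - (i + j)) Y := fun Y => by
    rw [PowerSeries.coeff_X_pow_mul', if_pos (by omega)]
  rw [potentialUp_one_eq_coeff hd, show
    PowerSeries.C (v i) * PowerSeries.X ^ i * (PowerSeries.C (v j) * PowerSeries.X ^ j) *
      (PowerSeries.X ^ (d - 1) * (1 + truncSeries d q)⁻¹) =
    PowerSeries.C (v i * v j) * (PowerSeries.X ^ (i + j) *
      (PowerSeries.X ^ (d - 1) * (1 + truncSeries d q)⁻¹)) by rw [map_mul]; ring,
    PowerSeries.coeff_C_mul, hs]
  ring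

/-- The Euler–Lagrange expressions of `L^{d,-N,0}` are coefficients of
`¼ (Q_x² / Q² - 2 Q_{xx} / Q)`. -/
lemma eulerLagrange_eq_coeff {n d N i : ℕ} (hi : i ∈ Icc 1 d) {q : ℕ → (Fin n → ℝ) → ℝ}
    {t : Fin n → ℝ} (hq : ∀ j ∈ Icc 1 d, DifferentiableAt ℝ (q j) t)
    (hqx : ∀ j ∈ Icc 1 d, DifferentiableAt ℝ (dx (q j)) t) :
    eulerLagrange (lagrangian d (-(N : ℤ)) 0) i q t =
      1 / 4 * PowerSeries.coeff (d + N + 1 - i)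
        ((truncSeries d fun j => dx (q j) t) ^ 2 * (1 + truncSeries d fun j => q j t)⁻¹ ^ 2
          - 2 * (truncSeries d fun j => dx (dx (q j)) t) *
            (1 + truncSeries d fun j => q j t)⁻¹) := by
  have hid := mem_Icc.1 hi
  have hd : 1 ≤ d := by omega
  have h1 (v : ℕ → ℝ) := constantCoeff_one_add_truncSeries d v
  simp only [eulerLagrange, lagrangian_eq_coeff hd]
  have hQ : deriv (fun y => 1 / 4 * PowerSeries.coeff (d + N + 1)
        ((truncSeries d fun j => dx (q j) t) ^ 2 *
          (1 + truncSeries d (Function.update (fun j => q j t) i y))⁻¹)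
        - 1 / 4 * (if 1 = d then 1 else 0)) (q i t) =
      1 / 4 * PowerSeries.coeff (d + N + 1) ((truncSeries d fun j => dx (q j) t) ^ 2 *
        (-(PowerSeries.X ^ i * (1 + truncSeries d fun j => q j t)⁻¹ ^ 2))) := by
    have h := ((hasCoeffDeriv_const ((truncSeries d fun j => dx (q j) t) ^ 2) (q i t) 1).mul
      (((hasCoeffDeriv_const 1 (q i t) 1).add (hasCoeffDeriv_truncSeries_update hi
        (fun j => q j t) (q i t))).inv fun _ => h1 _) (d + N + 1)).deriv
    rw [deriv_sub_const, deriv_const_mul_field, h]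
    simp [Function.update_eq_self]
  have hV : ∀ τ, deriv (fun w => 1 / 4 * PowerSeries.coeff (d + N + 1)
        (truncSeries d (Function.update (fun j => dx (q j) τ) i w) ^ 2 *
          (1 + truncSeries d fun j => q j τ)⁻¹)
        - 1 / 4 * (if 1 = d then 1 else 0)) (dx (q i) τ) =
      1 / 2 * PowerSeries.coeff (d + N + 1) (PowerSeries.X ^ i *
        ((truncSeries d fun j => dx (q j) τ) * (1 + truncSeries d fun j => q j τ)⁻¹)) := by
    intro τ
    have hu := hasCoeffDeriv_truncSeries_update hi (fun j => dx (q j) τ) (dx (q i) τ)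
    have h := (((hu.mul hu).mul (hasCoeffDeriv_const (1 + truncSeries d fun j => q j τ)⁻¹
      (dx (q i) τ) 1)) (d + N + 1)).deriv
    simp only [sq]
    rw [deriv_sub_const, deriv_const_mul_field, h]
    simp only [Function.update_eq_self, mul_zero, add_zero]
    rw [show (1 / 2 : ℝ) = 1 / 4 * 2 by norm_num, mul_assoc (1 / 4 : ℝ) 2, two_mul, ← map_add]
    congr 2
    ring
  simp only [hQ, hV]
  -- It remains to differentiate the momentum `½ [X^{d+N+1}] X^i Q_x / Q` along `x`.
  have hx : HasCoeffDeriv (fun τ => 1 + truncSeries d fun j => q j τ)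
      (0 + truncSeries d fun j => dx (q j) t) t (fun j => if (j : ℕ) + 1 = 1 then 1 else 0) :=
    (hasCoeffDeriv_const 1 _ _).add (hasCoeffDeriv_truncSeries fun j hj => ⟨hq j hj, rfl⟩)
  have hxx : HasCoeffDeriv (fun τ => truncSeries d fun j => dx (q j) τ)
      (truncSeries d fun j => dx (dx (q j)) t) t (fun j => if (j : ℕ) + 1 = 1 then 1 else 0) :=
    hasCoeffDeriv_truncSeries fun j hj => ⟨hqx j hj, rfl⟩
  have h := (((hasDirDeriv_const (1 / 2) _ _).mul
    (((hasCoeffDeriv_const (PowerSeries.X ^ i) _ _).mul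
      (hxx.mul (hx.inv fun _ => h1 _))) (d + N + 1))).2)
  rw [dx, dt, h]
  have hcomb : ∀ A B : PowerSeries ℝ, 1 / 4 * PowerSeries.coeff (d + N + 1) A
      - 1 / 2 * PowerSeries.coeff (d + N + 1) B
      = 1 / 4 * PowerSeries.coeff (d + N + 1) (A - (B + B)) := fun A B => by
    rw [map_sub, map_add]; ring
  simp only [zero_mul, zero_add]
  rw [hcomb]
  have hs : ∀ A : PowerSeries ℝ, PowerSeries.coeff (d + N + 1 - i) A =
      PowerSeries.coeff (d + N + 1) (PowerSeries.X ^ i * A) := fun A => by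
    rw [PowerSeries.coeff_X_pow_mul', if_pos (by omega)]
  rw [hs]
  congr 2
  ring

end Lagrangian

/-! ### Polynomials with prescribed roots -/

section Polynomials

/-- The polynomial `∏_{r ∈ s} (1 - z_r X)`. -/
noncomputable def rootPoly {ι : Type*} (s : Finset ι) (z : ι → ℝ) : Polynomial ℝ :=
  ∏ r ∈ s, (1 - Polynomial.C (z r) * Polynomial.X)

lemma coeff_rootPoly_univ {n : ℕ} (z : Fin n → ℝ) (i : ℕ) :
    (rootPoly univ z).coeff i = viete i z := by
  have h : ∀ S ∈ (univ : Finset (Fin n)).powerset,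
      (∏ r ∈ S, (-(Polynomial.C (z r) * Polynomial.X))).coeff i =
        if S.card = i then (-1) ^ i * ∏ r ∈ S, z r else 0 := fun S _ => by
    rw [prod_neg, prod_mul_distrib, prod_const, ← map_prod, ← mul_assoc,
      show ((-1 : Polynomial ℝ) ^ S.card) = Polynomial.C ((-1) ^ S.card) by simp, ← map_mul,
      Polynomial.coeff_C_mul_X_pow]
    simp only [eq_comm (a := i)]
    split_ifs with h
    · rw [h]
    · rfl
  simp only [rootPoly, sub_eq_add_neg, prod_one_add, Polynomial.finsetSum_coeff]
  rw [sum_congr rfl h, ← sum_filter, viete, mul_sum, powersetCard_eq_filter]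

lemma natDegree_rootPoly_le {ι : Type*} (s : Finset ι) (z : ι → ℝ) :
    (rootPoly s z).natDegree ≤ s.card := by
  refine (Polynomial.natDegree_prod_le _ _).trans ?_
  rw [card_eq_sum_ones]
  refine sum_le_sum fun r _ => ?_
  compute_degree

lemma coeff_zero_rootPoly {ι : Type*} (s : Finset ι) (z : ι → ℝ) :
    (rootPoly s z).coeff 0 = 1 := by
  rw [Polynomial.coeff_zero_eq_eval_zero, rootPoly, Polynomial.eval_prod]
  simp

lemma viete_zero {n : ℕ} (z : Fin n → ℝ) : viete 0 z = 1 := by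
  rw [← coeff_rootPoly_univ, coeff_zero_rootPoly]

lemma viete_of_lt {n i : ℕ} (h : n < i) (z : Fin n → ℝ) : viete i z = 0 := by
  rw [← coeff_rootPoly_univ]
  refine Polynomial.coeff_eq_zero_of_natDegree_lt ((natDegree_rootPoly_le _ _).trans_lt ?_)
  simpa using h

lemma rootPoly_univ_eq_mul {n : ℕ} (z : Fin n → ℝ) (r : Fin n) :
    rootPoly univ z = (1 - Polynomial.C (z r) * Polynomial.X) * rootPoly (univ.erase r) z :=
  (mul_prod_erase univ _ (mem_univ r)).symm

lemma viete_succ_eq {n : ℕ} (z : Fin n → ℝ) (r : Fin n) (k : ℕ) :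
    viete (k + 1) z =
      (rootPoly (univ.erase r) z).coeff (k + 1) - z r * (rootPoly (univ.erase r) z).coeff k := by
  rw [← coeff_rootPoly_univ, rootPoly_univ_eq_mul z r, sub_mul, one_mul, Polynomial.coeff_sub,
    mul_assoc, Polynomial.coeff_C_mul, Polynomial.coeff_X_mul]

lemma contDiff_coeff_rootPoly {ι : Type*} [Fintype ι] (s : Finset ι) (m : ℕ) {k : WithTop ℕ∞} :
    ContDiff ℝ k fun z : ι → ℝ => (rootPoly s z).coeff m := by
  classical
  induction s using Finset.induction_on generalizing m with
  | empty => simpa [rootPoly] using contDiff_const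
  | insert a s ha ih =>
    have h : ∀ z : ι → ℝ, rootPoly (insert a s) z =
        rootPoly s z - Polynomial.C (z a) * (Polynomial.X * rootPoly s z) := fun z => by
      rw [rootPoly, prod_insert ha, ← rootPoly]; ring
    simp only [h, Polynomial.coeff_sub, Polynomial.coeff_C_mul]
    refine (ih m).sub ((contDiff_apply ℝ ℝ a).mul ?_)
    cases m with
    | zero => simpa using contDiff_const
    | succ m => simpa only [Polynomial.coeff_X_mul] using ih m

lemma contDiff_viete {n : ℕ} (i : ℕ) {k : WithTop ℕ∞} :
    ContDiff ℝ k fun z : Fin n → ℝ => viete i z := by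
  simpa only [coeff_rootPoly_univ] using contDiff_coeff_rootPoly (univ : Finset (Fin n)) i

lemma eval_rootPoly_erase {n : ℕ} (z : Fin n → ℝ) (r s : Fin n) (hs : z s ≠ 0) :
    z s ^ (n - 1) * (rootPoly (univ.erase r) z).eval (z s)⁻¹ =
      ∏ k ∈ univ.erase r, (z s - z k) := by
  have hc : ((univ : Finset (Fin n)).erase r).card = n - 1 := by
    rw [card_erase_of_mem (mem_univ r), card_univ, Fintype.card_fin]
  rw [rootPoly, Polynomial.eval_prod, ← hc, ← prod_const, ← prod_mul_distrib]
  refine prod_congr rfl fun k _ => ?_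
  simp only [Polynomial.eval_sub, Polynomial.eval_one, Polynomial.eval_mul, Polynomial.eval_C,
    Polynomial.eval_X]
  field_simp

/-- The coefficients of `∏_{s ≠ r} (1 - z_s X)` invert the Vandermonde matrix `(z_s^{n-i})` up to
the factor `∏_{s ≠ r} (z_r - z_s)`. -/
lemma mul_prod_sub_eq_coeff {n : ℕ} {z y : Fin n → ℝ} (hz : ∀ r, z r ≠ 0) (j : Fin n)
    (h : ∀ i : Fin n, ∑ s, y s * z s ^ (n - ((i : ℕ) + 1)) = if i = j then 1 else 0) (r : Fin n) :
    y r * ∏ k ∈ univ.erase r, (z r - z k) = (rootPoly (univ.erase r) z).coeff j := by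
  have hev : ∀ s, ∑ i : Fin n, (rootPoly (univ.erase r) z).coeff i * z s ^ (n - ((i : ℕ) + 1)) =
      ∏ k ∈ univ.erase r, (z s - z k) := fun s => by
    have hdeg : (rootPoly (univ.erase r) z).natDegree < n := by
      refine (natDegree_rootPoly_le _ _).trans_lt ?_
      rw [card_erase_of_mem (mem_univ r), card_univ, Fintype.card_fin]
      have := r.2
      omega
    rw [← eval_rootPoly_erase z r s (hz s), Polynomial.eval_eq_sum_range' hdeg, mul_sum,
      ← Fin.sum_univ_eq_sum_range
        (fun i : ℕ => z s ^ (n - 1) * ((rootPoly (univ.erase r) z).coeff i * (z s)⁻¹ ^ i))]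
    refine sum_congr rfl fun i _ => ?_
    have hi := i.2
    have hp : z s ^ (n - 1) = z s ^ (n - ((i : ℕ) + 1)) * z s ^ (i : ℕ) := by
      rw [← pow_add]; congr 1; omega
    rw [hp, inv_pow]
    field_simp [hz s]
  calc y r * ∏ k ∈ univ.erase r, (z r - z k)
      = ∑ s, y s * ∏ k ∈ univ.erase r, (z s - z k) := by
        refine (sum_eq_single_of_mem (f := fun s => y s * ∏ k ∈ univ.erase r, (z s - z k)) r
          (mem_univ r) fun s _ hs => ?_).symm
        rw [prod_eq_zero (mem_erase.2 ⟨hs, mem_univ s⟩) (sub_self _), mul_zero]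
    _ = ∑ i : Fin n, (rootPoly (univ.erase r) z).coeff i *
          ∑ s, y s * z s ^ (n - ((i : ℕ) + 1)) := by
        simp only [← hev, mul_sum]
        rw [sum_comm]
        refine sum_congr rfl fun i _ => sum_congr rfl fun s _ => by ring
    _ = _ := by simp [h]

/-- If `q_k = p_k - l p_{k-1}`, the products `p_j p_{M-j}` are telescoping sums: this is why the
Killing fields are diagonal in the coordinates `λ`. -/
lemma mul_eq_telescoping_sum {p q : ℕ → ℝ} {l : ℝ} (hq : ∀ k, q (k + 1) = p (k + 1) - l * p k)
    (M j : ℕ) (hj : j ≤ M) :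
    p j * p (M - j) =
      p 0 * p M + ∑ k ∈ range j, (q (k + 1) * p (M - 1 - k) - q (M - k) * p k) := by
  induction j with
  | zero => simp
  | succ j ih =>
    have h1 : M - j = (M - (j + 1)) + 1 := by omega
    have h2 : M - 1 - j = M - (j + 1) := by omega
    have ih := ih (by omega)
    rw [sum_range_succ, h1, hq, hq, h2]
    rw [h1] at ih
    linear_combination ih

lemma sq_X_sub_C_dvd {S : Polynomial ℝ} {a : ℝ} (h0 : S.eval a = 0)
    (h1 : S.derivative.eval a = 0) : (Polynomial.X - Polynomial.C a) ^ 2 ∣ S := by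
  obtain ⟨G, rfl⟩ := Polynomial.dvd_iff_isRoot.2 h0
  rw [sq]
  refine mul_dvd_mul_left _ (Polynomial.dvd_iff_isRoot.2 ?_)
  simpa using h1

lemma exists_eq_rootPoly_sq_mul {n N : ℕ} {z : Fin n → ℝ} (hz : ∀ r, z r ≠ 0)
    (hinj : Function.Injective z) {S : Polynomial ℝ} (hdeg : S.natDegree ≤ 2 * n + N)
    (h0 : ∀ r, S.eval (z r)⁻¹ = 0) (h1 : ∀ r, S.derivative.eval (z r)⁻¹ = 0) :
    ∃ K : Polynomial ℝ, K.natDegree ≤ N ∧ S = rootPoly univ z ^ 2 * K := by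
  have hP : rootPoly univ z = Polynomial.C (∏ r, (-z r)) *
      ∏ r, (Polynomial.X - Polynomial.C (z r)⁻¹) := by
    rw [rootPoly, map_prod, ← prod_mul_distrib]
    refine prod_congr rfl fun r _ => ?_
    rw [mul_sub, ← map_mul, neg_mul, mul_inv_cancel₀ (hz r)]
    simp
    ring
  have hc : ∏ r, (-z r) ≠ 0 := prod_ne_zero_iff.2 fun r _ => neg_ne_zero.2 (hz r)
  have hdvd : (∏ r, (Polynomial.X - Polynomial.C (z r)⁻¹)) ^ 2 ∣ S := by
    rw [← prod_pow]
    refine Finset.prod_dvd_of_coprime (fun r _ s _ hrs => ?_) fun r _ => sq_X_sub_C_dvd (h0 r) (h1 r)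
    exact (Polynomial.isCoprime_X_sub_C_of_isUnit_sub
      (sub_ne_zero.2 fun h => hrs (hinj (inv_injective h))).isUnit).pow
  obtain ⟨G, hG⟩ := hdvd
  refine ⟨Polynomial.C ((∏ r, (-z r))⁻¹ ^ 2) * G, ?_, ?_⟩
  · refine (Polynomial.natDegree_C_mul_le _ _).trans ?_
    rcases eq_or_ne G 0 with rfl | hG0
    · simp
    · have hm : (∏ r, (Polynomial.X - Polynomial.C (z r)⁻¹)).Monic :=
        Polynomial.monic_prod_of_monic _ _ fun r _ => Polynomial.monic_X_sub_C _
      have hd : (∏ r, (Polynomial.X - Polynomial.C (z r)⁻¹)).natDegree = n := by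
        rw [Polynomial.natDegree_prod_of_monic _ _ fun r _ => Polynomial.monic_X_sub_C _]
        simp
      rw [hG, (hm.pow 2).natDegree_mul' hG0, hm.natDegree_pow, hd] at hdeg
      omega
  · rw [hP, mul_pow, mul_mul_mul_comm, ← map_pow, ← map_mul, ← mul_pow, mul_inv_cancel₀ hc, hG]
    simp

/-- Passing from `2 P P₂ - P₁² ≡ -P² K` to the quotient `2 P₂ / P - P₁² / P² ≡ -K`, for power series
that agree with `P, P₁, P₂` up to order `d`. -/
lemma coeff_quotient_eq {d m : ℕ} (hm : m ≤ d) {P P₁ P₂ Q Q₁ Q₂ K : PowerSeries ℝ}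
    (hQ : PowerSeries.constantCoeff Q = 1)
    (h : ∀ i ≤ d, PowerSeries.coeff i (P₁ ^ 2 - 2 * P * P₂ - P ^ 2 * K) = 0)
    (h0 : ∀ i ≤ d, PowerSeries.coeff i P = PowerSeries.coeff i Q)
    (h1 : ∀ i ≤ d, PowerSeries.coeff i P₁ = PowerSeries.coeff i Q₁)
    (h2 : ∀ i ≤ d, PowerSeries.coeff i P₂ = PowerSeries.coeff i Q₂) :
    PowerSeries.coeff m (Q₁ ^ 2 * Q⁻¹ ^ 2 - 2 * Q₂ * Q⁻¹) = PowerSeries.coeff m K := by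
  have hdvd : ∀ A B : PowerSeries ℝ, (∀ i ≤ d, PowerSeries.coeff i A = PowerSeries.coeff i B) →
      ∃ C, A = B + PowerSeries.X ^ (d + 1) * C := fun A B hAB => by
    have : PowerSeries.X ^ (d + 1) ∣ A - B := PowerSeries.X_pow_dvd_iff.2 fun i hi => by
      rw [map_sub, hAB i (by omega), sub_self]
    obtain ⟨C, hC⟩ := this
    exact ⟨C, by rw [← hC]; ring⟩
  obtain ⟨C, hC⟩ := hdvd (P₁ ^ 2 - 2 * P * P₂ - P ^ 2 * K) 0 fun i hi => by
    rw [h i hi, map_zero]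
  obtain ⟨C₀, rfl⟩ := hdvd _ _ h0
  obtain ⟨C₁, rfl⟩ := hdvd _ _ h1
  obtain ⟨C₂, rfl⟩ := hdvd _ _ h2
  have hinv : Q * Q⁻¹ = 1 := PowerSeries.mul_inv_cancel _ (by rw [hQ]; exact one_ne_zero)
  set Y := PowerSeries.X (R := ℝ) ^ (d + 1) with hY
  -- The congruence for `P, P₁, P₂` modulo `X^{d+1}` carries over to `Q, Q₁, Q₂`.
  have hmod : ∃ D, Q₁ ^ 2 - 2 * Q * Q₂ = Q ^ 2 * K + Y * D :=
    ⟨C - 2 * Q₁ * C₁ - Y * C₁ ^ 2 + 2 * Q * C₂ + 2 * C₀ * Q₂ + 2 * Y * C₀ * C₂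
      + 2 * Q * C₀ * K + Y * C₀ ^ 2 * K, by linear_combination hC⟩
  obtain ⟨D, hD⟩ := hmod
  have hfin : Q₁ ^ 2 * Q⁻¹ ^ 2 - 2 * Q₂ * Q⁻¹ = K + Y * (D * Q⁻¹ ^ 2) := by
    linear_combination Q⁻¹ ^ 2 * hD + (K * (Q * Q⁻¹ + 1) + 2 * Q₂ * Q⁻¹) * hinv
  rw [hfin, map_add, hY, PowerSeries.coeff_X_pow_mul', if_neg (by omega), add_zero]

end Polynomials

/-! ### Differentiating the quadratures -/

section Quadratures

variable {n : ℕ}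

/-- `dt` is a directional derivative. -/
lemma hasDirDeriv_dt {f : (Fin n → ℝ) → ℝ} {t : Fin n → ℝ} (hf : DifferentiableAt ℝ f t)
    (i : ℕ) : HasDirDeriv f (dt i f t) t (fun j => if (j : ℕ) + 1 = i then 1 else 0) :=
  ⟨hf, rfl⟩

lemma contDiffOn_radicand (m k : ℤ) (a : Fin n → ℝ) {l : WithTop ℕ∞} :
    ContDiffOn ℝ l (radicand n m k a) {z | z ≠ 0} := by
  have hz : ∀ p : ℤ, ContDiffOn ℝ l (fun z : ℝ => z ^ p) {z | z ≠ 0} := fun p => by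
    cases p with
    | ofNat p => simpa using (contDiff_id.pow p).contDiffOn
    | negSucc p =>
      simp only [zpow_negSucc]
      exact ((contDiff_id.pow (p + 1)).contDiffOn).inv fun z hz => pow_ne_zero _ hz
  refine (hz m).mul (ContDiffOn.sub ?_ (contDiffOn_const.mul (hz k)))
  exact ContDiffOn.sum fun j _ => (contDiff_const.mul (contDiff_id.pow _)).contDiffOn

/-- A differentiable solution of an autonomous total differential equation with smooth right-hand
side is smooth. -/
lemma contDiffOn_infty_of_fderiv_eq {E F : Type*} [NormedAddCommGroup E] [NormedSpace ℝ E]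
    [NormedAddCommGroup F] [NormedSpace ℝ F] {f : E → F} {G : F → E →L[ℝ] F} {U : Set E}
    {V : Set F} (hU : IsOpen U) (hG : ContDiffOn ℝ (⊤ : ℕ∞) G V) (hf : DifferentiableOn ℝ f U)
    (hUV : Set.MapsTo f U V) (h : ∀ t ∈ U, fderiv ℝ f t = G (f t)) :
    ContDiffOn ℝ (⊤ : ℕ∞) f U := by
  refine contDiffOn_infty.2 fun k => ?_
  induction k with
  | zero => exact contDiffOn_zero.2 hf.continuousOn
  | succ k ih =>
    rw [Nat.cast_add, Nat.cast_one, contDiffOn_succ_iff_fderiv_of_isOpen hU]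
    refine ⟨hf, by simp, ?_⟩
    exact ((contDiffOn_infty.1 hG k).comp ih hUV).congr h

/-- The functions `λ_r` satisfy `∂λ_r/∂t_i ∏_{s ≠ r} (λ_r - λ_s) = 2 w_r p_{i-1}`, where `w_r` is the
signed root and `p_0, p_1, …` are the coefficients of `∏_{s ≠ r} (1 - λ_s X)`. -/
lemma IsSeparableSolution.dt_mul_prod {m k : ℤ} {a c σ : Fin n → ℝ} {U : Set (Fin n → ℝ)}
    {lam : (Fin n → ℝ) → Fin n → ℝ} (h : IsSeparableSolution m k a c σ U lam)
    {t : Fin n → ℝ} (ht : t ∈ U) (j r : Fin n) :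
    dt ((j : ℕ) + 1) (fun τ => lam τ r) t * ∏ s ∈ univ.erase r, (lam t r - lam t s) =
      2 * (σ r * Real.sqrt (radicand n m k a (lam t r))) *
        (rootPoly (univ.erase r) (lam t)).coeff j := by
  obtain ⟨hU, hdiff, hσ, I, F, -, hI, hF, hmem, heq⟩ := h
  have hd : ∀ s, DifferentiableAt ℝ (fun τ => lam τ s) t := fun s =>
    differentiableAt_pi.1 (hdiff.differentiableAt (hU.mem_nhds ht)) s
  have hw : ∀ s, 0 < Real.sqrt (radicand n m k a (lam t s)) := fun s =>
    Real.sqrt_pos.2 (hI s _ (hmem t ht s)).2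
  have hlin : ∀ i : Fin n, ∑ s, (1 / 2 * (σ s * (dt ((j : ℕ) + 1) (fun τ => lam τ s) t /
      Real.sqrt (radicand n m k a (lam t s))))) * lam t s ^ (n - ((i : ℕ) + 1)) =
      if i = j then 1 else 0 := fun i => by
    have h1 := (hasDirDeriv_const (1 / 2) t _).mul (HasDirDeriv.sum (s := univ) fun s _ =>
      (hasDirDeriv_const (σ s) t _).mul
        (HasDirDeriv.comp (hF i s _ (hmem t ht s)) (hasDirDeriv_dt (hd s) ((j : ℕ) + 1))))
    have h2 : HasDirDeriv (fun τ : Fin n → ℝ => τ i + c i) (if i = j then 1 else 0) t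
        (fun l => if (l : ℕ) + 1 = (j : ℕ) + 1 then 1 else 0) := by
      have hi : HasFDerivAt (fun τ : Fin n → ℝ => τ i + c i)
        (ContinuousLinearMap.proj (R := ℝ) i) t := (hasFDerivAt_apply i t).add_const (c i)
      refine ⟨hi.differentiableAt, ?_⟩
      rw [hi.fderiv]
      simp [Fin.ext_iff]
    have h3 := h2.congr_of_eventuallyEq (g := fun τ => 1 / 2 * ∑ s, σ s * F i s (lam τ s))
      (by filter_upwards [hU.mem_nhds ht] with τ hτ using (heq τ hτ i).symm)
    rw [← h1.unique h3]
    simp only [zero_mul, zero_add, mul_sum, sum_const_zero]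
    refine sum_congr rfl fun s _ => ?_
    ring
  have hy := mul_prod_sub_eq_coeff (fun s => (hI s _ (hmem t ht s)).1) j hlin r
  have hσ2 : σ r * σ r = 1 := by rcases hσ r with h | h <;> rw [h] <;> norm_num
  have hne := (hw r).ne'
  rw [← hy]
  field_simp
  linear_combination (-(dt ((j : ℕ) + 1) (fun τ => lam τ r) t *
    ∏ s ∈ univ.erase r, (lam t r - lam t s))) * hσ2

variable {m k : ℤ} {a c σ : Fin n → ℝ} {U : Set (Fin n → ℝ)} {lam : (Fin n → ℝ) → Fin n → ℝ}

lemma IsSeparableSolution.isOpen (h : IsSeparableSolution m k a c σ U lam) : IsOpen U := h.1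

lemma IsSeparableSolution.differentiableAt (h : IsSeparableSolution m k a c σ U lam)
    {t : Fin n → ℝ} (ht : t ∈ U) (r : Fin n) : DifferentiableAt ℝ (fun τ => lam τ r) t :=
  differentiableAt_pi.1 (h.2.1.differentiableAt (h.1.mem_nhds ht)) r

lemma IsSeparableSolution.ne_zero (h : IsSeparableSolution m k a c σ U lam)
    {t : Fin n → ℝ} (ht : t ∈ U) (r : Fin n) : lam t r ≠ 0 := by
  obtain ⟨-, -, -, I, F, -, hI, -, hmem, -⟩ := h
  exact (hI r _ (hmem t ht r)).1

lemma IsSeparableSolution.radicand_pos (h : IsSeparableSolution m k a c σ U lam)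
    {t : Fin n → ℝ} (ht : t ∈ U) (r : Fin n) : 0 < radicand n m k a (lam t r) := by
  obtain ⟨-, -, -, I, F, -, hI, -, hmem, -⟩ := h
  exact (hI r _ (hmem t ht r)).2

lemma IsSeparableSolution.sigma_sq (h : IsSeparableSolution m k a c σ U lam) (r : Fin n) :
    σ r ^ 2 = 1 := by
  rcases h.2.2.1 r with h | h <;> rw [h] <;> norm_num

lemma IsSeparableSolution.dx_mul_prod (h : IsSeparableSolution m k a c σ U lam)
    {t : Fin n → ℝ} (ht : t ∈ U) (r : Fin n) :
    dx (fun τ => lam τ r) t * ∏ s ∈ univ.erase r, (lam t r - lam t s) =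
      2 * (σ r * Real.sqrt (radicand n m k a (lam t r))) := by
  have hr := r.2
  have h0 := h.dt_mul_prod ht ⟨0, by omega⟩ r
  rwa [coeff_zero_rootPoly, mul_one] at h0

lemma IsSeparableSolution.dx_mul_prod_ne_zero (h : IsSeparableSolution m k a c σ U lam)
    {t : Fin n → ℝ} (ht : t ∈ U) (r : Fin n) :
    dx (fun τ => lam τ r) t * ∏ s ∈ univ.erase r, (lam t r - lam t s) ≠ 0 := by
  rw [h.dx_mul_prod ht r]
  have h1 : σ r ≠ 0 := fun h0 => by simpa [h0] using h.sigma_sq r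
  exact mul_ne_zero two_ne_zero (mul_ne_zero h1 (Real.sqrt_pos.2 (h.radicand_pos ht r)).ne')

lemma IsSeparableSolution.injective (h : IsSeparableSolution m k a c σ U lam)
    {t : Fin n → ℝ} (ht : t ∈ U) : Function.Injective (lam t) := by
  intro r s hrs
  by_contra hne
  refine right_ne_zero_of_mul (h.dx_mul_prod_ne_zero ht r) ?_
  exact prod_eq_zero (mem_erase.2 ⟨fun h => hne h.symm, mem_univ s⟩) (sub_eq_zero.2 hrs)

/-- In the coordinates `λ` the flows are diagonal. -/
lemma IsSeparableSolution.dt_eq (h : IsSeparableSolution m k a c σ U lam)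
    {t : Fin n → ℝ} (ht : t ∈ U) {j : ℕ} (hj : j < n) (r : Fin n) :
    dt (j + 1) (fun τ => lam τ r) t =
      (rootPoly (univ.erase r) (lam t)).coeff j * dx (fun τ => lam τ r) t := by
  have h0 := right_ne_zero_of_mul (h.dx_mul_prod_ne_zero ht r)
  refine mul_right_cancel₀ h0 ?_
  rw [mul_assoc, h.dx_mul_prod ht r, mul_comm]
  have := h.dt_mul_prod ht ⟨j, hj⟩ r
  rw [mul_comm] at this
  rw [this, mul_comm]

lemma IsSeparableSolution.contDiffOn (h : IsSeparableSolution m k a c σ U lam) :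
    ContDiffOn ℝ (⊤ : ℕ∞) lam U := by
  let D : (Fin n → ℝ) → Fin n → ℝ := fun z r => ∏ s ∈ univ.erase r, (z r - z s)
  -- On `V` the total differential equation for `λ` has a smooth right-hand side.
  let V : Set (Fin n → ℝ) := {z | ∀ r, z r ≠ 0 ∧ 0 < radicand n m k a (z r) ∧ D z r ≠ 0}
  let G : (Fin n → ℝ) → (Fin n → ℝ) →L[ℝ] (Fin n → ℝ) := fun z => ∑ j : Fin n,
    (ContinuousLinearMap.proj (R := ℝ) (φ := fun _ : Fin n => ℝ) j).smulRight fun r =>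
      2 * (σ r * Real.sqrt (radicand n m k a (z r))) *
        (rootPoly (univ.erase r) z).coeff j / D z r
  have hD : ∀ t ∈ U, ∀ r, D (lam t) r ≠ 0 := fun t ht r =>
    right_ne_zero_of_mul (h.dx_mul_prod_ne_zero ht r)
  refine contDiffOn_infty_of_fderiv_eq (V := V) (G := G) h.1 ?_ h.2.1
    (fun t ht r => ⟨h.ne_zero ht r, h.radicand_pos ht r, hD t ht r⟩) fun t ht => ?_
  · refine ContDiffOn.sum fun j _ => contDiffOn_const.smulRight (contDiffOn_pi.2 fun r => ?_)
    have happ : ContDiffOn ℝ (⊤ : ℕ∞) (fun z : Fin n → ℝ => z r) V :=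
      (contDiff_apply ℝ ℝ r).contDiffOn
    refine ContDiffOn.div (ContDiffOn.mul (contDiffOn_const.mul (contDiffOn_const.mul
      (ContDiffOn.sqrt ?_ fun z hz => (hz r).2.1.ne')))
      (contDiff_coeff_rootPoly _ _).contDiffOn) ?_ fun z hz => (hz r).2.2
    · exact (contDiffOn_radicand m k a).comp happ fun z hz => (hz r).1
    · exact (contDiff_prod fun s _ =>
        (contDiff_apply ℝ ℝ r).sub (contDiff_apply ℝ ℝ s)).contDiffOn
  · refine ContinuousLinearMap.coe_injective (LinearMap.pi_ext' fun j => LinearMap.ext_ring ?_)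
    ext r
    have hd : HasFDerivAt lam (fderiv ℝ lam t) t :=
      (h.2.1.differentiableAt (h.1.mem_nhds ht)).hasFDerivAt
    have hr := (hasFDerivAt_pi'.1 hd r).fderiv
    have hv : (fun l : Fin n => if (l : ℕ) + 1 = (j : ℕ) + 1 then (1 : ℝ) else 0) =
        Pi.single j 1 := by
      ext l
      simp [Pi.single_apply, Fin.ext_iff]
    have hdt := h.dt_mul_prod ht j r
    rw [dt, hr, hv] at hdt
    have hG : G (lam t) (Pi.single j 1) r = 2 * (σ r * Real.sqrt (radicand n m k a (lam t r))) *
        (rootPoly (univ.erase r) (lam t)).coeff j / D (lam t) r := by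
      simp [G, Pi.single_apply, ite_apply]
    change fderiv ℝ lam t (Pi.single j 1) r = G (lam t) (Pi.single j 1) r
    rw [hG, eq_div_iff (hD t ht r)]
    exact hdt

end Quadratures

/-! ### The Killing systems -/

section Flows

variable {n : ℕ} {m k : ℤ} {a c σ : Fin n → ℝ} {U : Set (Fin n → ℝ)}
  {lam : (Fin n → ℝ) → Fin n → ℝ}

lemma contDiffOn_dx {f : (Fin n → ℝ) → ℝ} (hU : IsOpen U) (hf : ContDiffOn ℝ (⊤ : ℕ∞) f U) :
    ContDiffOn ℝ (⊤ : ℕ∞) (dx f) U :=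
  ((contDiffOn_infty_iff_fderiv_of_isOpen hU).1 hf).2.clm_apply contDiffOn_const

lemma IsSeparableSolution.contDiffOn_viete (h : IsSeparableSolution m k a c σ U lam) (i : ℕ) :
    ContDiffOn ℝ (⊤ : ℕ∞) (fun τ => viete i (lam τ)) U :=
  (contDiff_viete i).comp_contDiffOn h.contDiffOn

lemma IsSeparableSolution.differentiableAt_viete (h : IsSeparableSolution m k a c σ U lam) (i : ℕ)
    {t : Fin n → ℝ} (ht : t ∈ U) : DifferentiableAt ℝ (fun τ => viete i (lam τ)) t :=
  ((h.contDiffOn_viete i).differentiableOn (by simp)).differentiableAt (h.isOpen.mem_nhds ht)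

lemma IsSeparableSolution.differentiableAt_dx_viete (h : IsSeparableSolution m k a c σ U lam)
    (i : ℕ) {t : Fin n → ℝ} (ht : t ∈ U) :
    DifferentiableAt ℝ (dx fun τ => viete i (lam τ)) t :=
  ((contDiffOn_dx h.isOpen (h.contDiffOn_viete i)).differentiableOn (by simp)).differentiableAt
    (h.isOpen.mem_nhds ht)

lemma dt_viete {t : Fin n → ℝ} (hd : ∀ s, DifferentiableAt ℝ (fun τ => lam τ s) t)
    (j i : ℕ) :
    dt j (fun τ => viete (i + 1) (lam τ)) t =
      -∑ s, dt j (fun τ => lam τ s) t * (rootPoly (univ.erase s) (lam t)).coeff i := by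
  have hcoe : ∀ (S : Finset (Fin n)) (z : Fin n → ℝ), (rootPoly S z : PowerSeries ℝ) =
      ∏ r ∈ S, (1 + PowerSeries.C (-z r) * PowerSeries.X) := fun S z => by
    rw [← Polynomial.coeToPowerSeries.ringHom_apply, rootPoly, map_prod]
    refine prod_congr rfl fun r _ => ?_
    rw [map_sub, map_one, map_mul, Polynomial.coeToPowerSeries.ringHom_apply,
      Polynomial.coeToPowerSeries.ringHom_apply, Polynomial.coe_C, Polynomial.coe_X, map_neg]
    ring
  have hlin : ∀ s ∈ (univ : Finset (Fin n)), HasCoeffDeriv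
      (fun τ => 1 + PowerSeries.C (-lam τ s) * PowerSeries.X)
      (PowerSeries.C (-dt j (fun τ => lam τ s) t) * PowerSeries.X) t
      (fun l => if (l : ℕ) + 1 = j then 1 else 0) := fun s _ l => by
    simp only [map_add, PowerSeries.coeff_C_mul]
    have h := (hasDirDeriv_const (PowerSeries.coeff l (1 : PowerSeries ℝ)) t _).add
      (((hasDirDeriv_const (-1) t _).mul (hasDirDeriv_dt (hd s) j)).mul
        (hasDirDeriv_const (PowerSeries.coeff l (PowerSeries.X : PowerSeries ℝ)) t _))
    simpa using h
  have h := HasCoeffDeriv.prod hlin (i + 1)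
  simp only [← hcoe, Polynomial.coeff_coe, coeff_rootPoly_univ] at h
  refine h.2.trans ?_
  rw [map_sum, ← sum_neg_distrib]
  refine sum_congr rfl fun s _ => ?_
  rw [mul_assoc, PowerSeries.coeff_C_mul, PowerSeries.coeff_succ_X_mul, Polynomial.coeff_coe,
    neg_mul]

/-- The Viète polynomials of a separable solution solve the Killing systems. Each `λ_s` contributes
`-p_{j-1} p_{r-1} ∂λ_s/∂x` to `∂q_j/∂t_r`, and the product telescopes. -/
lemma IsSeparableSolution.dt_viete_eq_killingField (h : IsSeparableSolution m k a c σ U lam)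
    {t : Fin n → ℝ} (ht : t ∈ U) {d j r : ℕ} (hj : 1 ≤ j) (hr : 1 ≤ r) (hrn : r ≤ n)
    (hd : j + r - 1 ≤ d) :
    dt r (fun τ => viete j (lam τ)) t = killingField d r j (fun i τ => viete i (lam τ)) t := by
  obtain ⟨J, rfl⟩ := Nat.exists_eq_add_of_le' hj
  obtain ⟨ρ, rfl⟩ := Nat.exists_eq_add_of_le' hr
  have hcut : ∀ i ≤ d, cut d (fun i τ => viete i (lam τ)) i = fun τ => viete i (lam τ) :=
    fun i hi => if_pos hi
  have hdx : ∀ i, dx (fun τ => viete (i + 1) (lam τ)) t =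
      -∑ s, dx (fun τ => lam τ s) t * (rootPoly (univ.erase s) (lam t)).coeff i :=
    fun i => dt_viete (fun s => h.differentiableAt ht s) 1 i
  have hkill : killingField d (ρ + 1) (J + 1) (fun i τ => viete i (lam τ)) t =
      dx (fun τ => viete (J + ρ + 1) (lam τ)) t + ∑ l ∈ range J,
        (viete (l + 1) (lam t) * dx (fun τ => viete (J + ρ - 1 - l + 1) (lam τ)) t
          - viete (J + ρ - l) (lam t) * dx (fun τ => viete (l + 1) (lam τ)) t) := by
    have hIcc : Icc 1 (J + 1 - 1) = Ico 1 (J + 1) := by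
      ext l; rw [mem_Icc, mem_Ico]; omega
    rw [killingField, hIcc, sum_Ico_eq_sum_range, hcut _ hd,
      show J + 1 + (ρ + 1) - 1 = J + ρ + 1 by omega, Nat.add_sub_cancel]
    congr 1
    refine sum_congr rfl fun l hl => ?_
    have hl := mem_range.1 hl
    rw [show J + 1 + (ρ + 1) - (1 + l) - 1 = J + ρ - l by omega,
      show J + ρ - 1 - l + 1 = J + ρ - l by omega, add_comm 1 l, hcut _ (by omega),
      hcut _ (by omega)]
  rw [hkill, dt_viete fun s => h.differentiableAt ht s]
  simp only [hdx]
  have htel : ∀ s, (rootPoly (univ.erase s) (lam t)).coeff J *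
      (rootPoly (univ.erase s) (lam t)).coeff ρ =
      (rootPoly (univ.erase s) (lam t)).coeff (J + ρ) + ∑ l ∈ range J,
        (viete (l + 1) (lam t) * (rootPoly (univ.erase s) (lam t)).coeff (J + ρ - 1 - l)
          - viete (J + ρ - l) (lam t) * (rootPoly (univ.erase s) (lam t)).coeff l) := fun s => by
    have := mul_eq_telescoping_sum (p := fun i => (rootPoly (univ.erase s) (lam t)).coeff i)
      (q := fun i => viete i (lam t)) (viete_succ_eq (lam t) s) (J + ρ) J (by omega)
    simpa only [coeff_zero_rootPoly, one_mul, Nat.add_sub_cancel_left] using this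
  have hterm : ∀ s, dt (ρ + 1) (fun τ => lam τ s) t * (rootPoly (univ.erase s) (lam t)).coeff J =
      dx (fun τ => lam τ s) t * (rootPoly (univ.erase s) (lam t)).coeff (J + ρ) +
      ∑ l ∈ range J, dx (fun τ => lam τ s) t *
        (viete (l + 1) (lam t) * (rootPoly (univ.erase s) (lam t)).coeff (J + ρ - 1 - l)
          - viete (J + ρ - l) (lam t) * (rootPoly (univ.erase s) (lam t)).coeff l) := fun s => by
    rw [h.dt_eq ht (by omega), ← mul_sum, ← mul_add, ← htel s]
    ring
  simp only [hterm, sum_add_distrib, neg_add]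
  rw [sum_comm, ← sum_neg_distrib]
  congr 1
  rw [← sum_neg_distrib]
  refine sum_congr rfl fun l _ => ?_
  simp only [mul_sub, sum_sub_distrib, mul_neg, mul_sum]
  rw [neg_sub, sub_neg_eq_add, neg_add_eq_sub]
  congr 1 <;> refine sum_congr rfl fun s _ => by ring

end Flows

/-! ### The finite-gap equation -/

section FiniteGap

/-- The polynomial `c_0 + c_1 X + ⋯ + c_n X^n`. -/
noncomputable def polyOfCoeffs (n : ℕ) (c : ℕ → ℝ) : Polynomial ℝ :=
  ∑ i ∈ range (n + 1), Polynomial.C (c i) * Polynomial.X ^ i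

lemma coeff_polyOfCoeffs (n : ℕ) (c : ℕ → ℝ) (i : ℕ) :
    (polyOfCoeffs n c).coeff i = if i ≤ n then c i else 0 := by
  simp [polyOfCoeffs, Polynomial.finsetSum_coeff, Polynomial.coeff_X_pow]

lemma natDegree_polyOfCoeffs_le (n : ℕ) (c : ℕ → ℝ) : (polyOfCoeffs n c).natDegree ≤ n :=
  Polynomial.natDegree_le_iff_coeff_eq_zero.2 fun i hi => by
    rw [coeff_polyOfCoeffs, if_neg (by omega)]

/-- The chain rule for the value of a polynomial with varying coefficients at a varying point. -/
lemma hasDirDeriv_eval_polyOfCoeffs {E : Type*} [NormedAddCommGroup E] [NormedSpace ℝ E] {n : ℕ}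
    {f : ℕ → E → ℝ} {f' : ℕ → ℝ} {μ : E → ℝ} {μ' : ℝ} {x v : E}
    (hf : ∀ i, HasDirDeriv (f i) (f' i) x v) (hμ : HasDirDeriv μ μ' x v) :
    HasDirDeriv (fun y => (polyOfCoeffs n fun i => f i y).eval (μ y))
      ((polyOfCoeffs n f').eval (μ x)
        + (polyOfCoeffs n fun i => f i x).derivative.eval (μ x) * μ') x v := by
  have h := HasDirDeriv.sum (s := range (n + 1)) fun i _ =>
    (hf i).mul (HasDirDeriv.comp (hasDerivAt_pow i (μ x)) hμ)
  simp only [polyOfCoeffs, Polynomial.derivative_sum, Polynomial.eval_finsetSum,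
    Polynomial.eval_mul, Polynomial.eval_C, Polynomial.eval_pow, Polynomial.eval_X,
    Polynomial.derivative_C_mul_X_pow]
  convert h using 1
  rw [sum_mul, ← sum_add_distrib]
  refine sum_congr rfl fun i _ => ?_
  ring

variable {n N β : ℕ} {a c σ : Fin n → ℝ} {U : Set (Fin n → ℝ)}
  {lam : (Fin n → ℝ) → Fin n → ℝ}

/-- The spectral curve in the variable `X = 1/λ`: the value at `1/z` is `-4 z^{-2n}` times the radicand
at `z`. The factor `z^{-2n}` clears the negative powers of `X`. -/
noncomputable def curvePoly (N β : ℕ) (a : Fin n → ℝ) : Polynomial ℝ :=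
  Polynomial.X ^ (2 * n + N) -
    4 * ∑ j : Fin n, Polynomial.C (a j) * Polynomial.X ^ (N + n - β + j + 1)

lemma natDegree_curvePoly_le (hβ : β < n) (N : ℕ) (a : Fin n → ℝ) :
    (curvePoly N β a).natDegree ≤ 2 * n + N := by
  refine (Polynomial.natDegree_sub_le_of_le (m := 2 * n + N) (n := 2 * n + N)
    (Polynomial.natDegree_X_pow_le _) ?_).trans_eq (max_self _)
  rw [← map_ofNat (Polynomial.C (R := ℝ)) 4]
  refine (Polynomial.natDegree_C_mul_le _ _).trans
    (Polynomial.natDegree_sum_le_of_forall_le _ _ fun j _ => ?_)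
  have hj := j.2
  exact (Polynomial.natDegree_C_mul_X_pow_le _ _).trans (by omega)

lemma eval_curvePoly (hβ : β < n) (N : ℕ) (a : Fin n → ℝ) {z : ℝ} (hz : z ≠ 0) :
    (curvePoly N β a).eval z⁻¹ =
      -(4 * radicand n ((β : ℤ) - N) (-(β : ℤ)) a z * z⁻¹ ^ (2 * n)) := by
  have hterm : ∀ j : Fin n, z⁻¹ ^ (N + n - β + j + 1) =
      z ^ ((β : ℤ) - N) * z ^ (n - ((j : ℕ) + 1)) * z⁻¹ ^ (2 * n) := fun j => by
    have hj := j.2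
    rw [← zpow_natCast, ← zpow_natCast, ← zpow_natCast, inv_zpow', inv_zpow', ← zpow_add₀ hz,
      ← zpow_add₀ hz]
    congr 1
    omega
  have hlast : z⁻¹ ^ (2 * n + N) = z ^ ((β : ℤ) - N) * z ^ (-(β : ℤ)) * z⁻¹ ^ (2 * n) := by
    rw [← zpow_natCast, ← zpow_natCast, inv_zpow', inv_zpow', ← zpow_add₀ hz, ← zpow_add₀ hz]
    congr 1
    omega
  simp only [curvePoly, Polynomial.eval_sub, Polynomial.eval_mul, Polynomial.eval_finsetSum,
    Polynomial.eval_pow, Polynomial.eval_X, Polynomial.eval_C, Polynomial.eval_ofNat, radicand,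
    hterm, hlast]
  have hsum : ∑ j : Fin n, a j *
      (z ^ ((β : ℤ) - N) * z ^ (n - ((j : ℕ) + 1)) * z⁻¹ ^ (2 * n)) =
      z ^ ((β : ℤ) - N) * z⁻¹ ^ (2 * n) * ∑ j : Fin n, a j * z ^ (n - ((j : ℕ) + 1)) := by
    rw [mul_sum]
    exact sum_congr rfl fun j _ => by ring
  rw [hsum]
  ring

lemma coeff_curvePoly (hβ : β < n) (N : ℕ) (a : Fin n → ℝ) {i : ℕ} (hi : i ≤ N + n - β) :
    (curvePoly N β a).coeff i = 0 := by
  rw [curvePoly, Polynomial.coeff_sub, Polynomial.coeff_X_pow, if_neg (by omega),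
    ← map_ofNat (Polynomial.C (R := ℝ)) 4, Polynomial.coeff_C_mul,
    Polynomial.finsetSum_coeff, zero_sub, neg_eq_zero]
  refine mul_eq_zero_of_right _ (sum_eq_zero fun j _ => ?_)
  rw [Polynomial.coeff_C_mul_X_pow, if_neg (by omega)]

lemma rootPoly_eq_polyOfCoeffs (z : Fin n → ℝ) :
    rootPoly univ z = polyOfCoeffs n fun i => viete i z := by
  ext i
  rw [coeff_polyOfCoeffs, coeff_rootPoly_univ]
  split_ifs with h
  · rfl
  · exact viete_of_lt (by omega) z

lemma eval_rootPoly_univ {z : Fin n → ℝ} {r : Fin n} (hz : z r ≠ 0) :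
    (rootPoly univ z).eval (z r)⁻¹ = 0 := by
  rw [rootPoly, Polynomial.eval_prod]
  exact prod_eq_zero (mem_univ r) (by simp [hz])

lemma dx_viete_zero (lam : (Fin n → ℝ) → Fin n → ℝ) (t : Fin n → ℝ) :
    dx (fun τ => viete 0 (lam τ)) t = 0 := by
  simp [viete_zero, dx, dt]

lemma dx_viete_of_lt (lam : (Fin n → ℝ) → Fin n → ℝ) {i : ℕ} (hi : n < i) (t : Fin n → ℝ) :
    dx (fun τ => viete i (lam τ)) t = 0 := by
  simp [viete_of_lt hi, dx, dt]

/-- At the point `1/λ_r`, the square of the `x`-derivative of `∏_s (1 - λ_s X)` is given by the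
spectral curve: only `∂λ_r/∂x` contributes to the value there. -/
lemma IsSeparableSolution.eval_dx_sq_add_curvePoly
    (h : IsSeparableSolution ((β : ℤ) - N) (-(β : ℤ)) a c σ U lam) (hβ : β < n)
    {t : Fin n → ℝ} (ht : t ∈ U) (r : Fin n) :
    (polyOfCoeffs n fun i => dx (fun τ => viete i (lam τ)) t).eval (lam t r)⁻¹ ^ 2
      + (curvePoly N β a).eval (lam t r)⁻¹ = 0 := by
  have hz := h.ne_zero ht r
  have hpoly : (polyOfCoeffs n fun i => dx (fun τ => viete i (lam τ)) t) =
      -(Polynomial.X * ∑ s, Polynomial.C (dx (fun τ => lam τ s) t) *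
        rootPoly (univ.erase s) (lam t)) := by
    ext i
    have h0 : (polyOfCoeffs n fun i => dx (fun τ => viete i (lam τ)) t).coeff i =
        dx (fun τ => viete i (lam τ)) t := by
      rw [coeff_polyOfCoeffs]
      split_ifs with hi
      · rfl
      · exact (dx_viete_of_lt lam (by omega) t).symm
    rw [h0, Polynomial.coeff_neg]
    cases i with
    | zero => rw [dx_viete_zero, Polynomial.coeff_X_mul_zero, neg_zero]
    | succ i =>
      rw [Polynomial.coeff_X_mul, Polynomial.finsetSum_coeff, dx,
        dt_viete fun s => h.differentiableAt ht s]
      simp only [Polynomial.coeff_C_mul, dx]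
  have hsum : (∑ s, Polynomial.C (dx (fun τ => lam τ s) t) *
      rootPoly (univ.erase s) (lam t)).eval (lam t r)⁻¹ =
      dx (fun τ => lam τ r) t * (rootPoly (univ.erase r) (lam t)).eval (lam t r)⁻¹ := by
    rw [Polynomial.eval_finsetSum, sum_eq_single_of_mem r (mem_univ r) fun s _ hs => ?_,
      Polynomial.eval_mul, Polynomial.eval_C]
    rw [Polynomial.eval_mul, rootPoly, Polynomial.eval_prod,
      prod_eq_zero (mem_erase.2 ⟨hs.symm, mem_univ r⟩) (by simp [hz]), mul_zero]
  have hroot : dx (fun τ => lam τ r) t * (rootPoly (univ.erase r) (lam t)).eval (lam t r)⁻¹ =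
      2 * (σ r * Real.sqrt (radicand n ((β : ℤ) - N) (-(β : ℤ)) a (lam t r))) *
        (lam t r)⁻¹ ^ (n - 1) := by
    rw [← h.dx_mul_prod ht r, ← eval_rootPoly_erase _ _ _ hz, inv_pow]
    field_simp
  have hn : (lam t r)⁻¹ ^ (2 * n) = ((lam t r)⁻¹ * (lam t r)⁻¹ ^ (n - 1)) ^ 2 := by
    rw [← pow_succ', ← pow_mul]
    congr 1
    omega
  rw [hpoly, eval_curvePoly hβ N a hz, Polynomial.eval_neg, Polynomial.eval_mul, hsum, hroot,
    Polynomial.eval_X, hn]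
  have hs := Real.sq_sqrt (h.radicand_pos ht r).le
  linear_combination 4 * ((lam t r)⁻¹ * (lam t r)⁻¹ ^ (n - 1)) ^ 2 *
    (Real.sqrt (radicand n ((β : ℤ) - N) (-(β : ℤ)) a (lam t r)) ^ 2 * h.sigma_sq r + hs)

/-- The finite-gap equation `P_x² + C - 2 P P_{xx} = P² K` for `P = ∏_r (1 - λ_r X)`, with `C` given by
the spectral curve. The left-hand side vanishes to second order at every `1/λ_r`; for the derivative
this follows by differentiating `P = 0` and `P_x² + C = 0` along the moving point `1/λ_r`. -/
lemma IsSeparableSolution.exists_finiteGap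
    (h : IsSeparableSolution ((β : ℤ) - N) (-(β : ℤ)) a c σ U lam) (hβ : β < n)
    {t : Fin n → ℝ} (ht : t ∈ U) :
    ∃ K : Polynomial ℝ, K.natDegree ≤ N ∧
      (polyOfCoeffs n fun i => dx (fun τ => viete i (lam τ)) t) ^ 2 + curvePoly N β a
        - 2 * rootPoly univ (lam t) *
          (polyOfCoeffs n fun i => dx (dx fun τ => viete i (lam τ)) t) =
      rootPoly univ (lam t) ^ 2 * K := by
  have hnhds := h.isOpen.mem_nhds ht
  have hP : (rootPoly univ (lam t)).natDegree ≤ n := by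
    simpa using natDegree_rootPoly_le univ (lam t)
  have hmu : ∀ r, HasDirDeriv (fun τ => (lam τ r)⁻¹)
      (-(lam t r ^ 2)⁻¹ * dx (fun τ => lam τ r) t) t
      (fun l => if (l : ℕ) + 1 = 1 then 1 else 0) := fun r =>
    HasDirDeriv.comp (hasDerivAt_inv (h.ne_zero ht r)) (hasDirDeriv_dt (h.differentiableAt ht r) 1)
  refine exists_eq_rootPoly_sq_mul (h.ne_zero ht) (h.injective ht) ?_ (fun r => ?_) fun r => ?_
  · refine (Polynomial.natDegree_sub_le_of_le (m := 2 * n + N) (n := 2 * n + N)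
      (Polynomial.natDegree_add_le_of_degree_le ?_ (natDegree_curvePoly_le hβ N a))
      ?_).trans_eq (max_self _)
    · refine (Polynomial.natDegree_pow_le_of_le 2 (natDegree_polyOfCoeffs_le n _)).trans ?_
      omega
    · rw [← map_ofNat (Polynomial.C (R := ℝ)) 2, mul_assoc]
      refine (Polynomial.natDegree_C_mul_le _ _).trans
        ((Polynomial.natDegree_mul_le_of_le hP (natDegree_polyOfCoeffs_le n _)).trans ?_)
      omega
  · have h0 := h.eval_dx_sq_add_curvePoly hβ ht r
    simp only [Polynomial.eval_sub, Polynomial.eval_add, Polynomial.eval_pow, Polynomial.eval_mul,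
      eval_rootPoly_univ (h.ne_zero ht r)]
    linear_combination h0
  · -- `P(1/λ_r) = 0`, differentiated along `x`
    have e1 := (hasDirDeriv_eval_polyOfCoeffs (n := n)
      (fun i => hasDirDeriv_dt (h.differentiableAt_viete i ht) 1) (hmu r)).unique
      ((hasDirDeriv_const 0 t _).congr_of_eventuallyEq (by
        filter_upwards [hnhds] with τ hτ
        rw [← rootPoly_eq_polyOfCoeffs, eval_rootPoly_univ (h.ne_zero hτ r)]))
    -- `P_x(1/λ_r)² + C(1/λ_r) = 0`, differentiated along `x`
    have hx := hasDirDeriv_eval_polyOfCoeffs (n := n)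
      (fun i => hasDirDeriv_dt (h.differentiableAt_dx_viete i ht) 1) (hmu r)
    have e2 := ((hx.mul hx).add
      (HasDirDeriv.comp ((curvePoly N β a).hasDerivAt _) (hmu r))).unique
      ((hasDirDeriv_const 0 t _).congr_of_eventuallyEq (by
        filter_upwards [hnhds] with τ hτ
        rw [← sq]
        exact h.eval_dx_sq_add_curvePoly hβ hτ r))
    have hmu0 : -(lam t r ^ 2)⁻¹ * dx (fun τ => lam τ r) t ≠ 0 :=
      mul_ne_zero (neg_ne_zero.2 (inv_ne_zero (pow_ne_zero 2 (h.ne_zero ht r))))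
        (left_ne_zero_of_mul (h.dx_mul_prod_ne_zero ht r))
    refine mul_right_cancel₀ hmu0 ?_
    rw [← rootPoly_eq_polyOfCoeffs] at e1
    have hdx : ∀ f : (Fin n → ℝ) → ℝ, dt 1 f t = dx f t := fun _ => rfl
    simp only [hdx] at e1 e2
    have hroot := eval_rootPoly_univ (h.ne_zero ht r)
    simp only [Polynomial.derivative_sub, Polynomial.derivative_add, Polynomial.derivative_mul,
      Polynomial.derivative_sq, Polynomial.derivative_ofNat, Polynomial.eval_sub,
      Polynomial.eval_add, Polynomial.eval_mul, Polynomial.eval_C, Polynomial.eval_ofNat,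
      Polynomial.eval_zero, hroot]
    linear_combination e2 -
      2 * (polyOfCoeffs n fun i => dx (dx fun τ => viete i (lam τ)) t).eval (lam t r)⁻¹ * e1

end FiniteGap

end NonlocalCHD

theorem mainTheorem1 (n N β : ℕ) (hN : 1 ≤ N) (hβ : β < n)
    (a c σ : Fin n → ℝ) (U : Set (Fin n → ℝ)) (lam : (Fin n → ℝ) → Fin n → ℝ)
    (hlam : NonlocalCHD.IsSeparableSolution ((β : ℤ) - (N : ℤ)) (-(β : ℤ)) a c σ U lam) :
    NonlocalCHD.SolvesFirstFlows N (if β ≤ 1 then n - 1 else n - β) U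
      (fun i t => NonlocalCHD.viete i (lam t)) := by
  open NonlocalCHD in
  -- `R + 1 ≤ n` makes the times `t_2, …, t_{R+1}` available; `R ≤ n - β` keeps all
  -- exponents below the terms of the spectral curve, which start at `X^{N+n-β+1}`.
  obtain ⟨R, hR, hRn, hRβ⟩ : ∃ R, (if β ≤ 1 then n - 1 else n - β) = R ∧ R + 1 ≤ n ∧
      R ≤ n - β := by
    refine ⟨_, rfl, ?_⟩
    split_ifs <;> omega
  rw [hR]
  -- The nonlocal variables `q_{N+1}, …, q_{N+R}` are the next Viète polynomials (zero beyond `q_n`).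
  refine ⟨fun i t => viete i (lam t), fun j _ _ => Set.eqOn_refl _ _,
    fun j _ _ => hlam.contDiffOn_viete j, fun i hi hid t ht => ?_, fun r hr hrR j hj hjN t ht =>
      hlam.dt_viete_eq_killingField ht hj (by omega) (by omega) (by omega)⟩
  obtain ⟨K, hK, hgap⟩ := hlam.exists_finiteGap hβ ht
  rw [eulerLagrange_eq_coeff (mem_Icc.2 ⟨by omega, hid⟩)
    (fun j _ => hlam.differentiableAt_viete j ht) fun j _ => hlam.differentiableAt_dx_viete j ht]
  have hagree : ∀ f : ℕ → ℝ, (∀ l, n < l → f l = 0) → f 0 = 0 → ∀ l ≤ N + R,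
      PowerSeries.coeff l (polyOfCoeffs n f : PowerSeries ℝ) =
        PowerSeries.coeff l (truncSeries (N + R) f) := fun f hf hf0 l hl => by
    rw [Polynomial.coeff_coe, coeff_polyOfCoeffs, coeff_truncSeries]
    rcases Nat.eq_zero_or_pos l with rfl | hl0
    · simp [hf0]
    · rw [if_pos (mem_Icc.2 ⟨hl0, hl⟩)]
      split_ifs with hln
      · rfl
      · exact (hf l (by omega)).symm
  have hdx0 : ∀ f : (Fin n → ℝ) → ℝ, (∀ τ, f τ = 0) → dx f t = 0 := fun f hf => by
    rw [funext hf]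
    simp [dx, dt]
  rw [coeff_quotient_eq (d := N + R) (K := K) (P := rootPoly univ (lam t))
    (by omega) (constantCoeff_one_add_truncSeries _ _) ?_ ?_
    (hagree _ (fun l hl => dx_viete_of_lt lam hl t) (dx_viete_zero lam t))
    (hagree _ (fun l hl => hdx0 _ fun τ => dx_viete_of_lt lam hl τ)
      (hdx0 _ fun τ => dx_viete_zero lam τ)), Polynomial.coeff_coe,
    Polynomial.coeff_eq_zero_of_natDegree_lt (by omega), mul_zero]
  · intro l hl
    have hps := congrArg (fun p : Polynomial ℝ => p.coeff l) (show
      (polyOfCoeffs n fun i => dx (fun τ => viete i (lam τ)) t) ^ 2 -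
        2 * rootPoly univ (lam t) *
          (polyOfCoeffs n fun i => dx (dx fun τ => viete i (lam τ)) t) -
        rootPoly univ (lam t) ^ 2 * K = -curvePoly N β a by linear_combination hgap)
    simp only [Polynomial.coeff_neg, coeff_curvePoly hβ N a (show l ≤ N + n - β by omega),
      neg_zero] at hps
    rw [← Polynomial.coeff_coe] at hps
    rw [← hps]
    congr 1
    push_cast
    rw [show ((2 : Polynomial ℝ) : PowerSeries ℝ) = 2 from
      map_ofNat Polynomial.coeToPowerSeries.ringHom 2]
  · intro l hl
    rw [Polynomial.coeff_coe, coeff_rootPoly_univ, map_add, coeff_truncSeries,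
      PowerSeries.coeff_one]
    rcases Nat.eq_zero_or_pos l with rfl | hl0
    · simp [viete_zero]
    · simp [hl, hl0.ne']
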